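/- **Setting.** Let $p$ be a prime and $G$ a finite group (for instance $G\le \mathrm{Sym}(n)$). Let $EG$ be a contractible Hausdorff space with a free continuous right $G$-action, $BG=EG/G$, and $BH=EG/H$ for a subgroup $H\le G$. For a $G$-space $A$ let $EG\times_G A$ be the quotient of $EG\times A$ by $g:(v,x)\mapsto (v\cdot g^{-1},g\cdot x)$, and $H^*_G(A)=H^*(EG\times_G A;\mathbb F_p)$. (Co)chains are singular with $\mathbb F_p$-coefficients, $H^*=\bigoplus_n H^n$, $\cup$ is the cup product, and $\cap$ is the cap product, adjoint to $x\mapsto x\cup\varphi$. Let $$\Psi:C^n(EG)\to C^n(BG),\qquad \Psi(\varphi)(\sigma)=\sum_{\tau\text{ lifts }\sigma}\varphi(\tau),$$ the map that sends the cochain dual to a simplex of $EG$ to the cochain dual to its image in $BG$. An element $t\in H^*(BG;\mathbb F_p)$ *acts faithfully* if $x\mapsto x\cup t$ is injective on $H^*(BG;\mathbb F_p)$. The cohomology of $G$ is *detected by abelian subgroups* if there is a family of abelian subgroups $H_i\le G$ for which the restriction map $H^*(BG;\mathbb F_p)\to\prod_i H^*(BH_i;\mathbb F_p)$ is injective. The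 $G$-space $A$ satisfies the *Shift Assumption*, *demonstrated by* $t\in H^*(BG;\mathbb F_p)$, if $x\mapsto x\cup t_A$ is injective on $H_G^*(A)$, where $t_A$ is the image of $t$ under $H^*(BG)\to H_G^*(A)$, and if there is $\tilde t\in C^*(EG)$ such that $\Psi(\tilde t)$ is closed and $t=[\Psi(\tilde t)]$. **Theorem.** Suppose that the mod-$p$ cohomology of $G$ is detected by abelian subgroups and that $t\in H^*(BG;\mathbb F_p)$ acts faithfully. Then the point $\{pt\}$ with its $G$-action satisfies the Shift Assumption, and this is demonstrated by $t$. Hence, if $t$ is homogeneous of degree $q$, then the following additivity condition holds: there is $\tilde t\in C^q(EG)$ with $\Psi(\tilde t)$ closed and $[\Psi(\tilde t)]=t$, such that every closed chain $C\in C_i(EG\times_G\{pt\})$ is homologous to $T\cap\Psi(\tilde t)$ for some closed chain $T\in C_{i+q}(EG\times_G\{pt\})$ (where $\Psi(\tilde t)$ is pulled back along $EG\times_G\{pt\}\to BG$). -/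

import Mathlib

open scoped DirectSum

noncomputable section

namespace BorelCohomology

/-! ### Singular chains and cochains -/

section Singular

/-- A singular `n`-simplex of `X`. -/
abbrev SingularSimplex (X : Type*) [TopologicalSpace X] (n : ℕ) : Type _ :=
  C(stdSimplex ℝ (Fin (n + 1)), X)

variable {R : Type*} [CommRing R] {X Y : Type*} [TopologicalSpace X] [TopologicalSpace Y]

/-- Precomposition of a singular simplex with the affine map `Δ^m → Δ^n` that is given on
vertices by `f`. -/
def reindex {m n : ℕ} (f : Fin (m + 1) → Fin (n + 1)) (σ : SingularSimplex X n) :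
    SingularSimplex X m :=
  σ.comp ⟨stdSimplex.map f, stdSimplex.continuous_map f⟩

theorem reindex_reindex {l m n : ℕ} (g : Fin (l + 1) → Fin (m + 1))
    (f : Fin (m + 1) → Fin (n + 1)) (σ : SingularSimplex X n) :
    reindex g (reindex f σ) = reindex (f ∘ g) σ := by
  ext x
  simp [reindex, stdSimplex.map_comp_apply]

/-- The face opposite to the `k`-th vertex. -/
def face {n : ℕ} (k : Fin (n + 2)) (σ : SingularSimplex X (n + 1)) : SingularSimplex X n :=
  reindex k.succAbove σ

/-- The front `i`-face, spanned by the vertices `0, …, i`. -/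
def front {i j n : ℕ} (h : i + j = n) (σ : SingularSimplex X n) : SingularSimplex X i :=
  reindex (fun k ↦ ⟨k, by omega⟩) σ

/-- The back `j`-face, spanned by the vertices `i, …, i + j`. -/
def back {i j n : ℕ} (h : i + j = n) (σ : SingularSimplex X n) : SingularSimplex X j :=
  reindex (fun k ↦ ⟨i + k, by omega⟩) σ

/-- Singular `n`-cochains with coefficients in `R`. -/
abbrev Cochain (R : Type*) (X : Type*) [TopologicalSpace X] (n : ℕ) : Type _ :=
  SingularSimplex X n → R

/-- Singular `n`-chains with coefficients in `R`. -/
abbrev Chain (R : Type*) [CommRing R] (X : Type*) [TopologicalSpace X] (n : ℕ) : Type _ :=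
  SingularSimplex X n →₀ R

variable (R)

variable (X) in
/-- The singular coboundary. -/
def coboundary (n : ℕ) : Cochain R X n →ₗ[R] Cochain R X (n + 1) where
  toFun φ σ := ∑ k : Fin (n + 2), (-1) ^ (k : ℕ) * φ (face k σ)
  map_add' φ ψ := by
    ext σ
    simp [mul_add, Finset.sum_add_distrib]
  map_smul' c φ := by
    ext σ
    simp [Finset.mul_sum, mul_left_comm]

variable (X) in
/-- The singular boundary. -/
def boundary (n : ℕ) : Chain R X (n + 1) →ₗ[R] Chain R X n :=
  Finsupp.lift (Chain R X n) R (SingularSimplex X (n + 1))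
    fun σ ↦ ∑ k : Fin (n + 2), Finsupp.single (face k σ) ((-1) ^ (k : ℕ))

variable (X) in
def cocycles (n : ℕ) : Submodule R (Cochain R X n) := LinearMap.ker (coboundary R X n)

variable (X) in
def coboundaries : (n : ℕ) → Submodule R (Cochain R X n)
  | 0 => ⊥
  | n + 1 => LinearMap.range (coboundary R X n)

variable (X) in
def cycles : (n : ℕ) → Submodule R (Chain R X n)
  | 0 => ⊤
  | n + 1 => LinearMap.ker (boundary R X n)

variable (X) in
/-- The `n`-th singular cohomology `H^n(X; R)`. -/
abbrev Cohomology (n : ℕ) : Type _ :=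
  cocycles R X n ⧸ (coboundaries R X n).submoduleOf (cocycles R X n)

variable (X) in
/-- The total singular cohomology `H^*(X; R) = ⨁ n, H^n(X; R)`. -/
abbrev TotalCohomology : Type _ := ⨁ n, Cohomology R X n

variable {R}

/-- The class of a cocycle. -/
def cohomologyClass {n : ℕ} (φ : Cochain R X n) (h : φ ∈ cocycles R X n) : Cohomology R X n :=
  Submodule.Quotient.mk ⟨φ, h⟩

/-! ### Cup and cap products -/

/-- The Alexander–Whitney cup product of cochains. -/
def cochainCup {i j n : ℕ} (h : i + j = n) :
    Cochain R X i →ₗ[R] Cochain R X j →ₗ[R] Cochain R X n :=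
  LinearMap.mk₂ R (fun φ ψ σ ↦ φ (front h σ) * ψ (back h σ))
    (fun _ _ _ ↦ by ext; simp [add_mul]) (fun _ _ _ ↦ by ext; simp [mul_assoc])
    (fun _ _ _ ↦ by ext; simp [mul_add]) (fun _ _ _ ↦ by ext; simp [mul_left_comm])

/-- The cap product `σ ∩ φ = φ(back face of σ) • (front face of σ)`; it is the adjoint of
`x ↦ x ∪ φ` for the evaluation of cochains on chains. -/
def cap {i q n : ℕ} (h : i + q = n) (C : Chain R X n) (φ : Cochain R X q) : Chain R X i :=
  C.sum fun σ c ↦ Finsupp.single (front h σ) (c * φ (back h σ))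

theorem coboundary_cochainCup {i j n : ℕ} (h : i + j = n) (φ : Cochain R X i)
    (ψ : Cochain R X j) :
    coboundary R X n (cochainCup h φ ψ) =
      cochainCup (by omega : i + 1 + j = n + 1) (coboundary R X i φ) ψ +
        (-1 : R) ^ i • cochainCup (by omega : i + (j + 1) = n + 1) φ (coboundary R X j ψ) := by
  subst h
  ext σ
  have key : ∀ F : Fin (i + j + 2) → R, ∑ k, F k =
      ∑ k : Fin (i + 1), F ⟨k, by omega⟩ + ∑ k : Fin (j + 1), F ⟨i + 1 + k, by omega⟩ := by
    intro F
    rw [← Fintype.sum_equiv (finCongr (by omega : (i + 1) + (j + 1) = i + j + 2))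
      (fun k ↦ F (finCongr (by omega) k)) F (fun _ ↦ rfl), Fin.sum_univ_add]
    rfl
  have h1 : ∀ k : Fin (i + 1), front (rfl : i + j = i + j)
      (face (⟨k, by omega⟩ : Fin (i + j + 2)) σ) =
      face k.castSucc (front (by omega : i + 1 + j = i + j + 1) σ) := by
    intro k
    simp only [front, face, reindex_reindex]
    congr 1
    ext l
    simp only [Function.comp, Fin.succAbove, Fin.lt_def, Fin.val_castSucc]
    split_ifs <;> simp
  have h2 : ∀ k : Fin (i + 1), back (rfl : i + j = i + j)
      (face (⟨k, by omega⟩ : Fin (i + j + 2)) σ) =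
      back (by omega : i + 1 + j = i + j + 1) σ := by
    intro k
    simp only [back, face, reindex_reindex]
    congr 1
    ext l
    simp only [Function.comp, Fin.succAbove, Fin.lt_def, Fin.val_castSucc]
    split_ifs <;> simp <;> omega
  have h3 : ∀ k : Fin (j + 1), front (rfl : i + j = i + j)
      (face (⟨i + 1 + k, by omega⟩ : Fin (i + j + 2)) σ) =
      front (by omega : i + (j + 1) = i + j + 1) σ := by
    intro k
    simp only [front, face, reindex_reindex]
    congr 1
    ext l
    simp only [Function.comp, Fin.succAbove, Fin.lt_def, Fin.val_castSucc]
    split_ifs <;> simp <;> omega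
  have h4 : ∀ k : Fin (j + 1), back (rfl : i + j = i + j)
      (face (⟨i + 1 + k, by omega⟩ : Fin (i + j + 2)) σ) =
      face k.succ (back (by omega : i + (j + 1) = i + j + 1) σ) := by
    intro k
    simp only [back, face, reindex_reindex]
    congr 1
    ext l
    simp only [Function.comp, Fin.succAbove, Fin.lt_def, Fin.val_castSucc, Fin.val_succ]
    split_ifs <;> simp <;> omega
  have h5 : face (Fin.last (i + 1)) (front (by omega : i + 1 + j = i + j + 1) σ) =
      front (by omega : i + (j + 1) = i + j + 1) σ := by
    simp only [front, face, reindex_reindex]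
    congr 1
    ext l
    simp [Function.comp]
  have h6 : face 0 (back (by omega : i + (j + 1) = i + j + 1) σ) =
      back (by omega : i + 1 + j = i + j + 1) σ := by
    simp only [back, face, reindex_reindex]
    congr 1
    ext l
    simp only [Function.comp, Fin.succAbove_zero, Fin.val_succ]
    omega
  simp only [coboundary, cochainCup, LinearMap.coe_mk, AddHom.coe_mk, LinearMap.mk₂_apply,
    Pi.add_apply, Pi.smul_apply, smul_eq_mul]
  rw [key, Fin.sum_univ_castSucc (n := i + 1), Fin.sum_univ_succ (n := j + 1)]
  simp only [h1, h2, h3, h4, h5, h6, Fin.val_castSucc, Fin.val_last, Fin.val_succ,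
    Fin.val_zero, add_mul, mul_add, Finset.sum_mul, Finset.mul_sum, pow_add, pow_one, pow_zero]
  have e1 : ∀ a b c : R, a * (b * c) = a * b * c := fun a b c ↦ (mul_assoc a b c).symm
  have e2 : ∑ x : Fin (j + 1), (-1 : R) ^ i * -1 * (-1) ^ (x : ℕ) *
        (φ (front (by omega : i + (j + 1) = i + j + 1) σ) *
          ψ (face x.succ (back (by omega : i + (j + 1) = i + j + 1) σ))) =
      ∑ x : Fin (j + 1), (-1 : R) ^ i * (φ (front (by omega : i + (j + 1) = i + j + 1) σ) *
        ((-1) ^ (x : ℕ) * -1 *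
          ψ (face x.succ (back (by omega : i + (j + 1) = i + j + 1) σ)))) :=
    Finset.sum_congr rfl fun _ _ ↦ by ring
  have e3 : ∑ x : Fin (i + 1), (-1 : R) ^ (x : ℕ) *
        (φ (face x.castSucc (front (by omega : i + 1 + j = i + j + 1) σ)) *
          ψ (back (by omega : i + 1 + j = i + j + 1) σ)) =
      ∑ x : Fin (i + 1), (-1 : R) ^ (x : ℕ) *
        φ (face x.castSucc (front (by omega : i + 1 + j = i + j + 1) σ)) *
          ψ (back (by omega : i + 1 + j = i + j + 1) σ) :=
    Finset.sum_congr rfl fun _ _ ↦ by ring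
  rw [e2, e3]
  ring

theorem cochainCup_mem_cocycles {i j n : ℕ} (h : i + j = n) {φ : Cochain R X i}
    {ψ : Cochain R X j} (hφ : φ ∈ cocycles R X i) (hψ : ψ ∈ cocycles R X j) :
    cochainCup h φ ψ ∈ cocycles R X n := by
  rw [cocycles, LinearMap.mem_ker] at *
  rw [coboundary_cochainCup, hφ, hψ]
  simp

theorem cochainCup_mem_coboundaries_left {i j n : ℕ} (h : i + j = n) {φ : Cochain R X i}
    {ψ : Cochain R X j} (hφ : φ ∈ coboundaries R X i) (hψ : ψ ∈ cocycles R X j) :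
    cochainCup h φ ψ ∈ coboundaries R X n := by
  rw [cocycles, LinearMap.mem_ker] at hψ
  cases i with
  | zero =>
    obtain rfl : φ = 0 := by simpa [coboundaries] using hφ
    simp
  | succ i =>
    obtain ⟨θ, rfl⟩ := hφ
    obtain ⟨m, rfl⟩ : ∃ m, n = m + 1 := ⟨i + j, by omega⟩
    refine ⟨cochainCup (by omega : i + j = m) θ ψ, ?_⟩
    rw [coboundary_cochainCup, hψ]
    simp

theorem cochainCup_mem_coboundaries_right {i j n : ℕ} (h : i + j = n) {φ : Cochain R X i}
    {ψ : Cochain R X j} (hφ : φ ∈ cocycles R X i) (hψ : ψ ∈ coboundaries R X j) :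
    cochainCup h φ ψ ∈ coboundaries R X n := by
  rw [cocycles, LinearMap.mem_ker] at hφ
  cases j with
  | zero =>
    obtain rfl : ψ = 0 := by simpa [coboundaries] using hψ
    simp
  | succ j =>
    obtain ⟨θ, rfl⟩ := hψ
    obtain ⟨m, rfl⟩ : ∃ m, n = m + 1 := ⟨i + j, by omega⟩
    refine ⟨(-1 : R) ^ i • cochainCup (by omega : i + j = m) φ θ, ?_⟩
    rw [map_smul, coboundary_cochainCup, hφ]
    simp [smul_smul, ← mul_pow]

/-- The cup product `H^i(X; R) × H^j(X; R) → H^n(X; R)`, where `n = i + j`. -/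
def cup {i j n : ℕ} (h : i + j = n) :
    Cohomology R X i →ₗ[R] Cohomology R X j →ₗ[R] Cohomology R X n :=
  let f : cocycles R X i →ₗ[R] cocycles R X j →ₗ[R] Cohomology R X n :=
    LinearMap.mk₂ R
      (fun φ ψ ↦ cohomologyClass (cochainCup h φ.1 ψ.1) (cochainCup_mem_cocycles h φ.2 ψ.2))
      (fun φ φ' ψ ↦ by
        rw [cohomologyClass, cohomologyClass, cohomologyClass, ← Submodule.Quotient.mk_add]
        congr 1
        ext1
        simp)
      (fun c φ ψ ↦ by
        rw [cohomologyClass, cohomologyClass, ← Submodule.Quotient.mk_smul]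
        congr 1
        ext1
        simp)
      (fun φ ψ ψ' ↦ by
        rw [cohomologyClass, cohomologyClass, cohomologyClass, ← Submodule.Quotient.mk_add]
        congr 1
        ext1
        simp)
      (fun c φ ψ ↦ by
        rw [cohomologyClass, cohomologyClass, ← Submodule.Quotient.mk_smul]
        congr 1
        ext1
        simp)
  let g : Cohomology R X i →ₗ[R] cocycles R X j →ₗ[R] Cohomology R X n :=
    Submodule.liftQ _ f fun φ hφ ↦ by
      rw [LinearMap.mem_ker]
      ext1 ψ
      exact (Submodule.Quotient.mk_eq_zero _).2 (cochainCup_mem_coboundaries_left h hφ ψ.2)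
  LinearMap.flip <| Submodule.liftQ _ g.flip fun ψ hψ ↦ by
    rw [LinearMap.mem_ker]
    ext φ
    exact (Submodule.Quotient.mk_eq_zero _).2 (cochainCup_mem_coboundaries_right h φ.2 hψ)

theorem cup_cohomologyClass {i j n : ℕ} (h : i + j = n) (φ : Cochain R X i) (ψ : Cochain R X j)
    (hφ : φ ∈ cocycles R X i) (hψ : ψ ∈ cocycles R X j) :
    cup (R := R) (X := X) h (cohomologyClass φ hφ) (cohomologyClass ψ hψ) =
      cohomologyClass (cochainCup h φ ψ) (cochainCup_mem_cocycles h hφ hψ) :=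
  rfl

/-- The cup product on total cohomology, extended bilinearly from homogeneous classes. -/
def totalCup : TotalCohomology R X →ₗ[R] TotalCohomology R X →ₗ[R] TotalCohomology R X :=
  DirectSum.toModule R ℕ _ fun i ↦
    (DirectSum.toModule R ℕ _ fun j ↦
      ((cup (rfl : i + j = i + j)).compr₂
        (DirectSum.lof R ℕ (fun n ↦ Cohomology R X n) (i + j))).flip).flip

theorem totalCup_lof {i j : ℕ} (x : Cohomology R X i) (y : Cohomology R X j) :
    totalCup (DirectSum.lof R ℕ (fun n ↦ Cohomology R X n) i x)
        (DirectSum.lof R ℕ (fun n ↦ Cohomology R X n) j y) =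
      DirectSum.lof R ℕ (fun n ↦ Cohomology R X n) (i + j) (cup (R := R) (X := X) rfl x y) := by
  simp [totalCup]

/-- Multiplication by `t` is faithful: `x ↦ x ∪ t` is injective on `H^*(X; R)`. -/
def ActsFaithfully (t : TotalCohomology R X) : Prop :=
  Function.Injective fun x : TotalCohomology R X ↦ totalCup x t

/-! ### Functoriality -/

variable (R) in
/-- Pull-back of cochains along a continuous map. -/
def cochainMap (f : C(X, Y)) (n : ℕ) : Cochain R Y n →ₗ[R] Cochain R X n where
  toFun φ σ := φ (f.comp σ)
  map_add' _ _ := rfl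
  map_smul' _ _ := rfl

theorem coboundary_cochainMap (f : C(X, Y)) (n : ℕ) (φ : Cochain R Y n) :
    coboundary R X n (cochainMap R f n φ) = cochainMap R f (n + 1) (coboundary R Y n φ) :=
  rfl

variable (R) in
/-- The induced map on cocycles. -/
def cocyclesMap (f : C(X, Y)) (n : ℕ) : cocycles R Y n →ₗ[R] cocycles R X n :=
  (cochainMap R f n).restrict fun φ hφ ↦ by
    rw [cocycles, LinearMap.mem_ker] at *
    rw [coboundary_cochainMap, hφ, map_zero]

variable (R) in
/-- The induced map `f^* : H^n(Y; R) → H^n(X; R)`. -/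
def cohomologyMap (f : C(X, Y)) (n : ℕ) : Cohomology R Y n →ₗ[R] Cohomology R X n :=
  Submodule.mapQ _ _ (cocyclesMap R f n) fun φ hφ ↦ by
    cases n with
    | zero =>
      obtain rfl : φ = 0 := by
        ext1
        simpa [coboundaries, Submodule.submoduleOf] using hφ
      exact Submodule.zero_mem _
    | succ n =>
      obtain ⟨θ, hθ⟩ := hφ
      refine ⟨cochainMap R f n θ, ?_⟩
      rw [coboundary_cochainMap, hθ]
      rfl

variable (R) in
/-- The induced map `f^* : H^*(Y; R) → H^*(X; R)`. -/
def totalCohomologyMap (f : C(X, Y)) : TotalCohomology R Y →ₗ[R] TotalCohomology R X :=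
  DirectSum.lmap fun n ↦ cohomologyMap R f n

end Singular

/-! ### Classifying spaces and homotopy quotients

A right action of `G` on `E` is an action of `Gᵐᵒᵖ`, so that `v · g` is `MulOpposite.op g • v`. -/

section Equivariant

variable (G : Type*) [Group G] (E : Type*) [TopologicalSpace E] [MulAction Gᵐᵒᵖ E]

/-- `BG = E / G`. -/
abbrev ClassifyingSpace : Type _ := Quotient (MulAction.orbitRel Gᵐᵒᵖ E)

/-- The projection `E → BG`. -/
def toClassifyingSpace : C(E, ClassifyingSpace G E) :=
  ⟨Quotient.mk _, continuous_quotient_mk'⟩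

variable {G} in
/-- `BH = E / H` for a subgroup `H` of `G`, with `EH = E`. -/
abbrev SubgroupClassifyingSpace (H : Subgroup G) : Type _ :=
  Quotient (MulAction.orbitRel H.op E)

variable {G} in
/-- The map `BH → BG` induced by the inclusion of a subgroup. -/
def subgroupMap (H : Subgroup G) : C(SubgroupClassifyingSpace E H, ClassifyingSpace G E) where
  toFun := Quotient.map' id fun _ _ ⟨g, hg⟩ ↦ ⟨g.1, hg⟩
  continuous_toFun := continuous_id.quotient_map' _

variable (A : Type*) [TopologicalSpace A] [MulAction G A]

/-- The orbit relation of the action `g : (v, x) ↦ (v · g⁻¹, g · x)` on `E × A`. -/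
def homotopyOrbitSetoid : Setoid (E × A) where
  r a b := ∃ g : G, b = (MulOpposite.op g⁻¹ • a.1, g • a.2)
  iseqv :=
    { refl := fun a ↦ ⟨1, by simp⟩
      symm := by
        rintro a _ ⟨g, rfl⟩
        exact ⟨g⁻¹, by simp [smul_smul]⟩
      trans := by
        rintro a _ _ ⟨g, rfl⟩ ⟨h, rfl⟩
        exact ⟨h * g, by simp [smul_smul]⟩ }

/-- The homotopy quotient `E ×_G A`. -/
abbrev HomotopyQuotient : Type _ := Quotient (homotopyOrbitSetoid G E A)

/-- The projection `E ×_G A → BG`. -/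
def homotopyQuotientProj : C(HomotopyQuotient G E A, ClassifyingSpace G E) where
  toFun := Quotient.map' Prod.fst fun a b ⟨g, hg⟩ ↦
    (MulAction.orbitRel Gᵐᵒᵖ E).symm' ⟨MulOpposite.op g⁻¹, by rw [hg]⟩
  continuous_toFun := continuous_fst.quotient_map' _

variable {R : Type*} [CommRing R] {E}

/-- The map `Ψ : C^n(E) → C^n(BG)`, `Ψ(φ)(σ) = ∑ φ(τ)`, where the sum is over the simplices `τ`
of `E` that lift `σ` (a `G`-torsor when `G` is finite and acts freely on the Hausdorff space `E`).
It sends the cochain dual to a simplex `τ` to the cochain dual to the image of `τ` in `BG`. -/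
def transfer {n : ℕ} (φ : Cochain R E n) : Cochain R (ClassifyingSpace G E) n := fun σ ↦
  ∑ᶠ τ : {τ : SingularSimplex E n // (toClassifyingSpace G E).comp τ = σ}, φ τ.1

/-- A cochain `t'` on `E`, not necessarily homogeneous, represents the class `t` of `BG`: each
`Ψ(t'_n)` is a cocycle, whose class is the component of degree `n` of `t`. -/
def Represents (t' : ⨁ n, Cochain R E n) (t : TotalCohomology R (ClassifyingSpace G E)) : Prop :=
  ∀ n, ∃ h : transfer G (t' n) ∈ cocycles R (ClassifyingSpace G E) n,
    cohomologyClass (transfer G (t' n)) h = t n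

/-- The class `t` demonstrates that `A` with its `G`-action satisfies the Shift Assumption:
multiplication by the image of `t` is faithful on `H^*_G(A; R)`, and `t` is represented by a
cochain on `E`. -/
def DemonstratesShift (t : TotalCohomology R (ClassifyingSpace G E)) : Prop :=
  ActsFaithfully (totalCohomologyMap R (homotopyQuotientProj G E A) t) ∧
    ∃ t' : ⨁ n, Cochain R E n, Represents G t' t

variable (R E) in
/-- The Shift Assumption for `A` with its `G`-action. -/
def ShiftAssumption : Prop :=
  ∃ t : TotalCohomology R (ClassifyingSpace G E), DemonstratesShift G A t

/-- The additivity condition on `A` with its `G`-action, with a global choice of the cochain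
`t'` in `C^q(E)`: `Ψ(t')` is closed, and each closed chain `C` of `E ×_G A` is homologous to
`T ∩ Ψ(t')` for some closed chain `T`. -/
def AdditivityCondition {q : ℕ} (t' : Cochain R E q) : Prop :=
  transfer G t' ∈ cocycles R (ClassifyingSpace G E) q ∧
    ∀ (i : ℕ), ∀ C ∈ cycles R (HomotopyQuotient G E A) i,
      ∃ T ∈ cycles R (HomotopyQuotient G E A) (i + q),
        ∃ D : Chain R (HomotopyQuotient G E A) (i + 1),
          C = cap rfl T (cochainMap R (homotopyQuotientProj G E A) q (transfer G t')) +
            boundary R (HomotopyQuotient G E A) i D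

variable (R E) in
/-- The cohomology of `G` is detected by abelian subgroups: there is a family of abelian subgroups
`H` of `G` such that `H^*(BG; R) → ∏ H^*(BH; R)` is injective. -/
def DetectedByAbelianSubgroups : Prop :=
  ∃ 𝓗 : Set (Subgroup G), (∀ H ∈ 𝓗, IsMulCommutative H) ∧
    Function.Injective fun (x : TotalCohomology R (ClassifyingSpace G E)) (H : 𝓗) ↦
      totalCohomologyMap R (subgroupMap E H.1) x

end Equivariant

end BorelCohomology

end

/-! Three independent facts carry the theorem. Homotopy quotient of a point: the projection `E ×_G
{pt} → BG` is a homeomorphism, so pull-back is a bijection compatible with cup products and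
faithfulness of `t` passes to its image (`ActsFaithfully.homotopyQuotient_point`). Representability:
a finite group acting freely on a Hausdorff space gives a covering `E → BG`, so every simplex of
`BG` lifts. A cochain concentrated on one chosen lift per simplex has any prescribed image under
`Ψ`, hence every class is represented (`transfer_surjective`, `exists_represents`). Additivity: cap
with `ψ` is adjoint to cup with `ψ`. Over a field, injectivity of `y ↦ y ∪ [ψ]` therefore forces
surjectivity of `T ↦ T ∩ ψ` on homology; a linear functional separating a cycle from the image would
be a nonzero class killed by the cup product (`exists_eq_cap_add_boundary`). No
finite-dimensionality is needed. -/

namespace BorelCohomology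

/-! ### Functoriality of cup products and transport of faithfulness -/

section Functoriality

variable {R : Type*} [CommRing R] {X Y Z : Type*} [TopologicalSpace X] [TopologicalSpace Y]
  [TopologicalSpace Z]

theorem cohomologyMap_id (n : ℕ) (x : Cohomology R X n) :
    cohomologyMap R (ContinuousMap.id X) n x = x := by
  induction x using Submodule.Quotient.induction_on with
  | H φ => rfl

theorem cohomologyMap_comp (f : C(X, Y)) (g : C(Y, Z)) (n : ℕ) (x : Cohomology R Z n) :
    cohomologyMap R f n (cohomologyMap R g n x) = cohomologyMap R (g.comp f) n x := by
  induction x using Submodule.Quotient.induction_on with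
  | H φ => rfl

theorem cohomologyMap_cup (f : C(X, Y)) {i j n : ℕ} (h : i + j = n) (x : Cohomology R Y i)
    (y : Cohomology R Y j) :
    cohomologyMap R f n (cup (R := R) (X := Y) h x y) =
      cup (R := R) (X := X) h (cohomologyMap R f i x) (cohomologyMap R f j y) := by
  induction x using Submodule.Quotient.induction_on with
  | H φ =>
    induction y using Submodule.Quotient.induction_on with
    | H ψ => rfl

theorem totalCohomologyMap_lof (f : C(X, Y)) (n : ℕ) (x : Cohomology R Y n) :
    totalCohomologyMap R f (DirectSum.lof R ℕ (fun n ↦ Cohomology R Y n) n x) =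
      DirectSum.lof R ℕ (fun n ↦ Cohomology R X n) n (cohomologyMap R f n x) :=
  DirectSum.lmap_lof _ _ _

theorem totalCohomologyMap_comp_eq_id (f : C(X, Y)) (g : C(Y, X))
    (h : g.comp f = ContinuousMap.id X) (x : TotalCohomology R X) :
    totalCohomologyMap R f (totalCohomologyMap R g x) = x := by
  induction x using DirectSum.induction_on with
  | zero => simp
  | of n x =>
    rw [← DirectSum.lof_eq_of R, totalCohomologyMap_lof, totalCohomologyMap_lof,
      cohomologyMap_comp, h, cohomologyMap_id]
  | add x y hx hy => rw [map_add, map_add, hx, hy]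

theorem totalCohomologyMap_totalCup (f : C(X, Y)) (x y : TotalCohomology R Y) :
    totalCohomologyMap R f (totalCup x y) =
      totalCup (totalCohomologyMap R f x) (totalCohomologyMap R f y) := by
  induction x using DirectSum.induction_on with
  | zero => simp
  | add x x' hx hx' => simp only [map_add, LinearMap.add_apply, hx, hx']
  | of i x =>
    induction y using DirectSum.induction_on with
    | zero => simp
    | add y y' hy hy' => simp only [map_add, hy, hy']
    | of j y =>
      simp only [← DirectSum.lof_eq_of R, totalCup_lof, totalCohomologyMap_lof, cohomologyMap_cup]

/-- Faithfulness of a class is invariant under homeomorphisms. -/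
theorem ActsFaithfully.totalCohomologyMap {t : TotalCohomology R Y} (ht : ActsFaithfully t)
    (f : C(X, Y)) (g : C(Y, X)) (hgf : g.comp f = ContinuousMap.id X)
    (hfg : f.comp g = ContinuousMap.id Y) : ActsFaithfully (totalCohomologyMap R f t) := by
  intro x y hxy
  -- Applying `g^*` turns `x ∪ f^* t` into `g^* x ∪ t`, where faithfulness of `t` applies.
  have h := congrArg (BorelCohomology.totalCohomologyMap R g) hxy
  simp only [totalCohomologyMap_totalCup, totalCohomologyMap_comp_eq_id g f hfg] at h
  rw [← totalCohomologyMap_comp_eq_id f g hgf x, ht h, totalCohomologyMap_comp_eq_id f g hgf]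

/-- Each degree is a direct summand of total cohomology, and multiplication by a homogeneous class
respects the grading, so faithfulness can be tested degree by degree. -/
theorem ActsFaithfully.cup_injective {q : ℕ} {x : Cohomology R X q}
    (hx : ActsFaithfully (DirectSum.lof R ℕ (fun n ↦ Cohomology R X n) q x)) (i : ℕ) :
    Function.Injective fun y : Cohomology R X i ↦
      cup (R := R) (X := X) (rfl : i + q = i + q) y x := by
  intro y z hyz
  refine DirectSum.of_injective (β := fun n ↦ Cohomology R X n) i (hx ?_)
  simp only [← DirectSum.lof_eq_of R, totalCup_lof]
  exact congrArg _ hyz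

end Functoriality

/-! ### Duality between chains and cochains, cup and cap -/

section Evaluation

variable {R : Type*} [CommRing R] {X : Type*} [TopologicalSpace X]

/-- Stokes' formula, without sign because the coboundary is the plain transpose of the boundary. -/
theorem linearCombination_boundary {n : ℕ} (φ : Cochain R X n) (C : Chain R X (n + 1)) :
    Finsupp.linearCombination R φ (boundary R X n C) =
      Finsupp.linearCombination R (coboundary R X n φ) C := by
  induction C using Finsupp.induction_linear with
  | zero => simp
  | add C D hC hD => rw [map_add, map_add, map_add, hC, hD]
  | single σ c => simp [boundary, coboundary, Finsupp.linearCombination_single]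

/-- The cap product with a fixed cochain, as a linear map. -/
noncomputable def capLinear {i q n : ℕ} (h : i + q = n) (ψ : Cochain R X q) : Chain R X n →ₗ[R] Chain R X i :=
  Finsupp.linearCombination R fun σ ↦ Finsupp.single (front h σ) (ψ (back h σ))

theorem capLinear_apply {i q n : ℕ} (h : i + q = n) (ψ : Cochain R X q) (C : Chain R X n) :
    capLinear h ψ C = cap h C ψ := by
  simp [capLinear, cap, Finsupp.linearCombination_apply]

/-- The cap product is adjoint to the cup product. -/
theorem linearCombination_cap {i q n : ℕ} (h : i + q = n) (φ : Cochain R X i)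
    (ψ : Cochain R X q) (C : Chain R X n) :
    Finsupp.linearCombination R φ (cap h C ψ) =
      Finsupp.linearCombination R (cochainCup h φ ψ) C := by
  rw [← capLinear_apply]
  induction C using Finsupp.induction_linear with
  | zero => simp
  | add C D hC hD => rw [map_add, map_add, map_add, hC, hD]
  | single σ c =>
    simp only [capLinear, cochainCup, Finsupp.linearCombination_single, Finsupp.smul_single,
      LinearMap.mk₂_apply, smul_eq_mul]
    ring

theorem linearCombination_eq_zero_of_mem_coboundaries {n : ℕ} {φ : Cochain R X n}
    (hφ : φ ∈ coboundaries R X n) {C : Chain R X n} (hC : C ∈ cycles R X n) :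
    Finsupp.linearCombination R φ C = 0 := by
  cases n with
  | zero =>
    obtain rfl : φ = 0 := by simpa [coboundaries] using hφ
    simp
  | succ n =>
    obtain ⟨θ, rfl⟩ := hφ
    rw [← linearCombination_boundary, LinearMap.mem_ker.1 hC, map_zero]

variable {K : Type*} [Field K]

/-- Over a field, a cochain that vanishes on all cycles is a coboundary. -/
theorem mem_coboundaries_of_forall_cycles {n : ℕ} {φ : Cochain K X n}
    (hφ : ∀ C ∈ cycles K X n, Finsupp.linearCombination K φ C = 0) :
    φ ∈ coboundaries K X n := by
  cases n with
  | zero =>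
    have : φ = 0 := by
      ext σ
      -- Every 0-chain is a cycle, so evaluation on single simplices already gives `φ = 0`.
      simpa using hφ (Finsupp.single σ 1) trivial
    rw [this]
    exact Submodule.zero_mem _
  | succ n =>
    -- A functional vanishing on `ker ∂` factors through `∂`; over a field the factor extends to all
    -- `n`-chains, and its values on simplices give the primitive of `φ`.
    have h : Finsupp.linearCombination K φ ∈
        (LinearMap.ker (boundary K X n)).dualAnnihilator :=
      (Submodule.mem_dualAnnihilator _).2 hφ
    rw [← LinearMap.range_dualMap_eq_dualAnnihilator_ker] at h
    obtain ⟨f, hf⟩ := h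
    refine ⟨fun σ ↦ f (Finsupp.single σ 1), ?_⟩
    have hlc : Finsupp.linearCombination K (fun σ ↦ f (Finsupp.single σ 1)) = f := by
      ext σ
      simp
    ext σ
    have h1 := linearCombination_boundary (fun σ ↦ f (Finsupp.single σ 1)) (Finsupp.single σ 1)
    have h2 := LinearMap.congr_fun hf (Finsupp.single σ 1)
    rw [hlc] at h1
    rw [LinearMap.dualMap_apply, h1] at h2
    simpa using h2

/-- Over a field, if the cup product with the class of `ψ` is injective in degree `i`, then the
cap product with `ψ` is surjective on homology in degree `i`. -/
theorem exists_eq_cap_add_boundary {i q : ℕ} (ψ : Cochain K X q) (hψ : ψ ∈ cocycles K X q)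
    (hinj : Function.Injective fun y : Cohomology K X i ↦
      cup (R := K) (X := X) (rfl : i + q = i + q) y (cohomologyClass ψ hψ))
    {C : Chain K X i} (hC : C ∈ cycles K X i) :
    ∃ T ∈ cycles K X (i + q), ∃ D : Chain K X (i + 1),
      C = cap rfl T ψ + boundary K X i D := by
  suffices h : C ∈ (cycles K X (i + q)).map (capLinear rfl ψ) ⊔ LinearMap.range (boundary K X i) by
    obtain ⟨_, ⟨T, hT, rfl⟩, _, ⟨D, rfl⟩, h⟩ := Submodule.mem_sup.1 h
    exact ⟨T, hT, D, by rw [← h, capLinear_apply]⟩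
  by_contra hnot
  -- Here `f` kills all boundaries and all caps of cycles with `ψ`, but not `C`. The former make `φ`
  -- a cocycle; the latter, by adjunction, make `φ ∪ ψ` a coboundary.
  obtain ⟨f, hfC, hf⟩ := Submodule.exists_le_ker_of_notMem hnot
  set φ : Cochain K X i := fun σ ↦ f (Finsupp.single σ 1) with hφdef
  have hlc : Finsupp.linearCombination K φ = f := by
    ext σ
    simp [hφdef]
  have hφ : φ ∈ cocycles K X i := by
    rw [cocycles, LinearMap.mem_ker]
    ext σ
    have h1 := linearCombination_boundary φ (Finsupp.single σ 1)
    rw [hlc, LinearMap.mem_ker.1 (hf (Submodule.mem_sup_right ⟨_, rfl⟩))] at h1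
    simpa using h1.symm
  have hcup : cochainCup rfl φ ψ ∈ coboundaries K X (i + q) := by
    refine mem_coboundaries_of_forall_cycles fun T hT ↦ ?_
    rw [← linearCombination_cap, hlc, ← capLinear_apply]
    exact LinearMap.mem_ker.1 (hf (Submodule.mem_sup_left ⟨T, hT, rfl⟩))
  have hclass : cohomologyClass φ hφ = 0 := by
    refine hinj ?_
    simp only [map_zero, LinearMap.zero_apply, cup_cohomologyClass]
    exact (Submodule.Quotient.mk_eq_zero _).2 hcup
  have hcob : φ ∈ coboundaries K X i :=
    (Submodule.Quotient.mk_eq_zero ((coboundaries K X i).submoduleOf (cocycles K X i))).1 hclass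
  -- By injectivity `φ` is a coboundary, so it vanishes on the cycle `C`, contrary to the choice of
  -- `f`.
  exact hfC (by rw [← hlc]; exact linearCombination_eq_zero_of_mem_coboundaries hcob hC)

end Evaluation

/-! ### Covering spaces, lifts of simplices and surjectivity of `Ψ` -/

section Lifting

/-- A free action of a finite group by homeomorphisms of a Hausdorff space is a covering space
action. -/
theorem isQuotientCoveringMap_of_finite (G E : Type*) [Group G] [Finite G] [TopologicalSpace E]
    [T2Space E] [MulAction G E] [ContinuousConstSMul G E]
    (hfree : ∀ (g : G) (v : E), g • v = v → g = 1) :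
    IsQuotientCoveringMap (Quotient.mk (MulAction.orbitRel G E)) G where
  __ := isQuotientMap_quotient_mk'
  continuous_const_smul := continuous_const_smul
  apply_eq_iff_mem_orbit := Quotient.eq''
  disjoint e := by
    have hsep : ∀ g : G, ∃ U ∈ nhds e, ((g • ·) '' U ∩ U).Nonempty → g = 1 := by
      intro g
      by_cases hg : g = 1
      · exact ⟨Set.univ, Filter.univ_mem, fun _ ↦ hg⟩
      · obtain ⟨V, W, hV, hW, heV, heW, hVW⟩ := t2_separation fun h : g • e = e ↦ hg (hfree g e h)
        refine ⟨(g • ·) ⁻¹' V ∩ W, Filter.inter_mem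
          ((continuous_const_smul g).continuousAt.preimage_mem_nhds (hV.mem_nhds heV))
          (hW.mem_nhds heW), ?_⟩
        rintro ⟨_, ⟨x, hx, rfl⟩, -, hxW⟩
        exact (Set.disjoint_left.1 hVW hx.1 hxW).elim
    choose U hU hU' using hsep
    -- Finiteness of `G` keeps this intersection a neighbourhood of `e`.
    refine ⟨⋂ g, U g, Filter.iInter_mem.2 hU, fun g hg ↦ hU' g (hg.mono ?_)⟩
    exact Set.inter_subset_inter (Set.image_mono (Set.iInter_subset _ g)) (Set.iInter_subset _ g)

/-- A map from a contractible space lifts along a surjective covering map. -/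
theorem exists_lift_of_contractibleSpace {A E X : Type*} [TopologicalSpace A]
    [TopologicalSpace E] [TopologicalSpace X] [ContractibleSpace A] {p : C(E, X)}
    (hp : IsCoveringMap p) (hsurj : Function.Surjective p) (f : C(A, X)) :
    ∃ F : C(A, E), p.comp F = f := by
  obtain ⟨a, ⟨H⟩⟩ := id_nullhomotopic A
  obtain ⟨e, he⟩ := hsurj (f a)
  -- The contraction is reversed so that the homotopy starts at the constant map `f a`, which lifts
  -- to the constant `e`. The lifted homotopy at time 1 then lifts `f`.
  let L : C(unitInterval × A, X) := f.comp H.symm.toContinuousMap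
  have hL : ∀ b, L (0, b) = p (ContinuousMap.const A e b) := fun b ↦ by
    simp [L, he]
  refine ⟨(hp.liftHomotopy L _ hL).comp ((ContinuousMap.const A 1).prodMk (.id A)), ?_⟩
  ext b
  have h := congrFun (hp.liftHomotopy_lifts L _ hL) (1, b)
  simpa [L] using h

instance contractibleSpace_stdSimplex (n : ℕ) : ContractibleSpace (stdSimplex ℝ (Fin (n + 1))) :=
  (convex_stdSimplex ℝ (Fin (n + 1))).contractibleSpace ⟨_, single_mem_stdSimplex ℝ 0⟩

variable {G : Type*} [Group G] {E : Type*} [TopologicalSpace E] [MulAction Gᵐᵒᵖ E]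

theorem exists_lift_singularSimplex [Finite G] [T2Space E] [ContinuousConstSMul Gᵐᵒᵖ E]
    (hfree : ∀ (g : G) (v : E), MulOpposite.op g • v = v → g = 1) {n : ℕ}
    (σ : SingularSimplex (ClassifyingSpace G E) n) :
    ∃ τ : SingularSimplex E n, (toClassifyingSpace G E).comp τ = σ := by
  refine exists_lift_of_contractibleSpace ?_ Quotient.mk_surjective σ
  have : Finite Gᵐᵒᵖ := Finite.of_equiv G MulOpposite.opEquiv
  refine (isQuotientCoveringMap_of_finite Gᵐᵒᵖ E fun g v h ↦ ?_).isCoveringMap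
  exact MulOpposite.unop_injective (hfree g.unop v h)

variable {R : Type*} [CommRing R]

@[simp]
theorem transfer_zero (n : ℕ) : transfer G (0 : Cochain R E n) = 0 := by
  ext σ
  simp [transfer]

/-- If every simplex of `BG` lifts to `E`, then `Ψ` is surjective on cochains. -/
theorem transfer_surjective {n : ℕ} (hlift : ∀ σ : SingularSimplex (ClassifyingSpace G E) n,
      ∃ τ : SingularSimplex E n, (toClassifyingSpace G E).comp τ = σ) :
    Function.Surjective (transfer G : Cochain R E n → Cochain R (ClassifyingSpace G E) n) := by
  classical
  intro c
  choose s hs using hlift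
  -- The cochain is supported on the chosen lifts, so the sum over the lifts of `σ` has the single
  -- term at `s σ`.
  refine ⟨fun τ ↦ if τ = s ((toClassifyingSpace G E).comp τ) then
    c ((toClassifyingSpace G E).comp τ) else 0, ?_⟩
  ext σ
  rw [transfer, finsum_eq_single _ ⟨s σ, hs σ⟩]
  · simp [hs]
  · rintro ⟨τ, rfl⟩ hne
    exact if_neg fun h ↦ hne (Subtype.ext h)

theorem exists_cohomologyClass_transfer_eq {n : ℕ}
    (hlift : ∀ σ : SingularSimplex (ClassifyingSpace G E) n,
      ∃ τ : SingularSimplex E n, (toClassifyingSpace G E).comp τ = σ)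
    (x : Cohomology R (ClassifyingSpace G E) n) :
    ∃ (t' : Cochain R E n) (h : transfer G t' ∈ cocycles R (ClassifyingSpace G E) n),
      cohomologyClass (transfer G t') h = x := by
  induction x using Submodule.Quotient.induction_on with
  | H φ =>
    obtain ⟨t', ht'⟩ := transfer_surjective hlift φ.1
    exact ⟨t', ht' ▸ φ.2, congrArg Submodule.Quotient.mk (Subtype.ext ht')⟩

theorem exists_represents
    (hlift : ∀ (n : ℕ) (σ : SingularSimplex (ClassifyingSpace G E) n),
      ∃ τ : SingularSimplex E n, (toClassifyingSpace G E).comp τ = σ)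
    (t : TotalCohomology R (ClassifyingSpace G E)) :
    ∃ t' : ⨁ n, Cochain R E n, Represents G t' t := by
  classical
  choose s hs hst using fun n ↦ exists_cohomologyClass_transfer_eq (hlift n) (t n)
  -- Truncation to the support of `t` is needed: where `t n = 0` the chosen `s n` may still be a
  -- nonzero cochain.
  refine ⟨DirectSum.mk _ (DFinsupp.support t) fun n ↦ s n, fun n ↦ ?_⟩
  by_cases hn : n ∈ DFinsupp.support t
  · have h : DirectSum.mk (fun n ↦ Cochain R E n) (DFinsupp.support t) (fun n ↦ s n) n = s n :=
      DirectSum.mk_apply_of_mem hn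
    rw [h]
    exact ⟨hs n, hst n⟩
  · have h : DirectSum.mk (fun n ↦ Cochain R E n) (DFinsupp.support t) (fun n ↦ s n) n = 0 :=
      DirectSum.mk_apply_of_notMem hn
    have ht : t n = 0 := DFinsupp.notMem_support_iff.1 hn
    rw [h, ht]
    simp only [transfer_zero]
    exact ⟨Submodule.zero_mem _, Submodule.Quotient.mk_zero _⟩

end Lifting

/-! ### The homotopy quotient of a point, and additivity -/

section Point

variable (G : Type*) [Group G] (E : Type*) [TopologicalSpace E] [MulAction Gᵐᵒᵖ E]

/-- The inverse `BG → E ×_G {pt}` of the projection. -/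
def homotopyQuotientPointSection : C(ClassifyingSpace G E, HomotopyQuotient G E PUnit.{1}) where
  toFun := Quotient.map' (fun v ↦ (v, PUnit.unit)) fun v w ⟨g, hg⟩ ↦
    -- The orbit relation supplies `g • w = v`, whereas the homotopy quotient asks for `w` as the
    -- translate of `v` by an inverse; hence `g.unop` itself.
    ⟨g.unop, by simp [← hg]⟩
  continuous_toFun := (Continuous.prodMk_left PUnit.unit).quotient_map' _

theorem homotopyQuotientPointSection_comp_proj :
    (homotopyQuotientPointSection G E).comp (homotopyQuotientProj G E PUnit.{1}) =
      ContinuousMap.id _ := by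
  ext ⟨v, _⟩
  rfl

theorem homotopyQuotientProj_comp_pointSection :
    (homotopyQuotientProj G E PUnit.{1}).comp (homotopyQuotientPointSection G E) =
      ContinuousMap.id _ := by
  ext ⟨v⟩
  rfl

variable {G E}

theorem ActsFaithfully.homotopyQuotient_point {R : Type*} [CommRing R]
    {t : TotalCohomology R (ClassifyingSpace G E)} (ht : ActsFaithfully t) :
    ActsFaithfully (BorelCohomology.totalCohomologyMap R
      (homotopyQuotientProj G E PUnit.{1}) t) :=
  ht.totalCohomologyMap _ _ (homotopyQuotientPointSection_comp_proj G E)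
    (homotopyQuotientProj_comp_pointSection G E)

/-- Over a field, a cochain whose transfer represents a class that acts faithfully on the Borel
cohomology of `A` satisfies the additivity condition on `A`. -/
theorem additivityCondition_of_actsFaithfully {K : Type*} [Field K] {A : Type*}
    [TopologicalSpace A] [MulAction G A] {q : ℕ} {t' : Cochain K E q}
    (h : transfer G t' ∈ cocycles K (ClassifyingSpace G E) q)
    (hfaithful : ActsFaithfully (BorelCohomology.totalCohomologyMap K (homotopyQuotientProj G E A)
      (DirectSum.lof K ℕ (fun n ↦ Cohomology K (ClassifyingSpace G E) n) q
        (cohomologyClass (transfer G t') h)))) :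
    AdditivityCondition G A t' := by
  refine ⟨h, fun i C hC ↦ ?_⟩
  rw [totalCohomologyMap_lof] at hfaithful
  exact exists_eq_cap_add_boundary _
    (cocyclesMap K (homotopyQuotientProj G E A) q ⟨_, h⟩).2 (hfaithful.cup_injective i) hC

end Point

end BorelCohomology

theorem mainTheorem8 (p : ℕ) [Fact p.Prime] (G : Type*) [Group G] [Finite G]
    (E : Type*) [TopologicalSpace E] [T2Space E] [ContractibleSpace E]
    [MulAction Gᵐᵒᵖ E] [ContinuousConstSMul Gᵐᵒᵖ E]
    (hfree : ∀ (g : G) (v : E), MulOpposite.op g • v = v → g = 1)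
    (hdetect : BorelCohomology.DetectedByAbelianSubgroups G E (ZMod p))
    (t : BorelCohomology.TotalCohomology (ZMod p) (BorelCohomology.ClassifyingSpace G E))
    (ht : BorelCohomology.ActsFaithfully t) :
    BorelCohomology.ShiftAssumption G E PUnit.{1} (ZMod p) ∧
      BorelCohomology.DemonstratesShift G PUnit.{1} t ∧
      ∀ (q : ℕ) (x : BorelCohomology.Cohomology (ZMod p) (BorelCohomology.ClassifyingSpace G E) q),
        t = DirectSum.of
          (fun n ↦ BorelCohomology.Cohomology (ZMod p) (BorelCohomology.ClassifyingSpace G E) n)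
          q x →
        ∃ t' : BorelCohomology.Cochain (ZMod p) E q,
          (∃ h : BorelCohomology.transfer G t' ∈
              BorelCohomology.cocycles (ZMod p) (BorelCohomology.ClassifyingSpace G E) q,
            BorelCohomology.cohomologyClass (BorelCohomology.transfer G t') h = x) ∧
          BorelCohomology.AdditivityCondition G PUnit.{1} t' := by
  have hlift := fun n ↦ BorelCohomology.exists_lift_singularSimplex (n := n) hfree
  have hshift : BorelCohomology.DemonstratesShift G PUnit.{1} t :=
    ⟨ht.homotopyQuotient_point, BorelCohomology.exists_represents hlift t⟩
  refine ⟨⟨t, hshift⟩, hshift, ?_⟩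
  rintro q x rfl
  obtain ⟨t', h, rfl⟩ := BorelCohomology.exists_cohomologyClass_transfer_eq (hlift q) x
  exact ⟨t', ⟨h, rfl⟩, BorelCohomology.additivityCondition_of_actsFaithfully h hshift.1⟩
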